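/- Let $S^3\subset\mathbb H$ be the unit quaternions, and identify a tangent vector of $S^3\times S^3$ at $(p,q)$ with a pair $(U,V)$ of quaternions, $U\in T_pS^3$, $V\in T_qS^3$. Put $$J(U,V)=\tfrac1{\sqrt3}\,(2pq^{-1}V-U,\,-2qp^{-1}U+V),\qquad P(U,V)=(pq^{-1}V,\,qp^{-1}U),$$ $$g(X,Y)=\tfrac12\bigl(\langle X,Y\rangle+\langle JX,JY\rangle\bigr),$$ where $\langle\cdot,\cdot\rangle$ is the standard product metric. Let $M$ be a smooth surface and $\phi=(p,q):M\to S^3\times S^3$ a smooth immersion whose tangent planes $d\phi(T_xM)$ are $J$-invariant (an almost complex surface), and give $M$ the complex structure on its tangent spaces for which $d\phi$ intertwines it with $J$. By isothermal coordinates we mean a smooth local coordinate system $z=u+iv$ on an open subset of $M$ in which the metric induced by $g$ is a multiple of $du^2+dv^2$, oriented so that $J\phi_u=\phi_v$. For such coordinates let $\phi_z=\frac12(\phi_u-i\phi_v)$, let $\Lambda=g(P\phi_z,\phi_z)$ (with $P$ extended complex linearly and $g$ complex bilinearly), and let $\alpha=p^{-1}p_u$, $\beta=p^{-1}p_v$,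 which take values in the imaginary quaternions $\cong\mathbb R^3$ with dot product $\cdot$. Then $\Lambda$ is a holomorphic function of $z$ for all isothermal coordinates $z$, and $\Lambda\,dz^2$ is globally defined: there is a holomorphic quadratic differential $Q$ on $M$ which equals $\Lambda\,dz^2$ on the domain of every isothermal coordinate system. For each isothermal coordinate system with domain $U\subseteq M$, the following are equivalent: (i) $\Lambda\,dz^2=0$ on $U$; (ii) $\alpha\cdot\alpha-\beta\cdot\beta=0$ and $\alpha\cdot\beta=0$ on $U$; (iii) $P(T_xM)\perp T_xM$ with respect to $g$ for all $x\in U$ (where $T_xM$ is identified with $d\phi(T_xM)$). Globally, $Q=0$ on $M$ if and only if $P(TM)\perp TM$; and for any family of isothermal coordinate systems whose domains cover $M$, both are equivalent to (ii) holding in each coordinate system of the family. -/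

import Mathlib

open scoped Manifold ContDiff TensorProduct Quaternion

noncomputable section

namespace NearlyKahler

instance finrankQuaternion : Fact (Module.finrank ℝ ℍ[ℝ] = 3 + 1) :=
  ⟨Quaternion.finrank_eq_four⟩

/-- The unit 3-sphere of unit quaternions, with Mathlib's smooth structure on spheres. -/
abbrev S3 : Type := Metric.sphere (0 : ℍ[ℝ]) 1

/-- The inclusion of `S³ × S³` into `ℍ × ℍ`. A tangent vector of `S³ × S³` at `m = (p, q)` is
identified with its image `(U, V) ∈ ℍ × ℍ` under the differential of this inclusion. -/
def incl (m : S3 × S3) : ℍ[ℝ] × ℍ[ℝ] := (m.1, m.2)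

/-- The almost complex structure at `(p, q)`:
`J (U, V) = (1 / √3) (2 p q⁻¹ V - U, -2 q p⁻¹ U + V)`. -/
def J (m : S3 × S3) : (ℍ[ℝ] × ℍ[ℝ]) →ₗ[ℝ] (ℍ[ℝ] × ℍ[ℝ]) where
  toFun X := (1 / √3 : ℝ) •
    ((2 : ℝ) • ((m.1 : ℍ[ℝ]) * (m.2 : ℍ[ℝ])⁻¹ * X.2) - X.1,
      (-2 : ℝ) • ((m.2 : ℍ[ℝ]) * (m.1 : ℍ[ℝ])⁻¹ * X.1) + X.2)
  map_add' X Y := by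
    rw [← smul_add]
    congr 1
    ext1 <;> simp only [Prod.fst_add, Prod.snd_add, mul_add, smul_add] <;> abel
  map_smul' r X := by
    rw [RingHom.id_apply, smul_comm r]
    congr 1
    ext1
    · simp only [Prod.smul_fst, Prod.smul_snd, mul_smul_comm, smul_sub, smul_comm r]
    · simp only [Prod.smul_fst, Prod.smul_snd, mul_smul_comm, smul_add, smul_comm r]

/-- The almost product structure at `(p, q)`: `P (U, V) = (p q⁻¹ V, q p⁻¹ U)`. -/
def P (m : S3 × S3) : (ℍ[ℝ] × ℍ[ℝ]) →ₗ[ℝ] (ℍ[ℝ] × ℍ[ℝ]) where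
  toFun X := ((m.1 : ℍ[ℝ]) * (m.2 : ℍ[ℝ])⁻¹ * X.2, (m.2 : ℍ[ℝ]) * (m.1 : ℍ[ℝ])⁻¹ * X.1)
  map_add' X Y := by ext1 <;> simp only [Prod.fst_add, Prod.snd_add, mul_add]
  map_smul' r X := by
    ext1 <;> simp only [Prod.smul_fst, Prod.smul_snd, mul_smul_comm, RingHom.id_apply]

/-- The standard product metric `⟨(U, V), (U', V')⟩ = ⟨U, U'⟩ + ⟨V, V'⟩`. -/
def prodMetric : LinearMap.BilinForm ℝ (ℍ[ℝ] × ℍ[ℝ]) :=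
  (innerₗ ℍ[ℝ]).compl₁₂ (LinearMap.fst ℝ ℍ[ℝ] ℍ[ℝ]) (LinearMap.fst ℝ ℍ[ℝ] ℍ[ℝ]) +
    (innerₗ ℍ[ℝ]).compl₁₂ (LinearMap.snd ℝ ℍ[ℝ] ℍ[ℝ]) (LinearMap.snd ℝ ℍ[ℝ] ℍ[ℝ])

/-- The nearly Kähler metric `g (X, Y) = (1 / 2) (⟨X, Y⟩ + ⟨J X, J Y⟩)`. -/
def g (m : S3 × S3) : LinearMap.BilinForm ℝ (ℍ[ℝ] × ℍ[ℝ]) :=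
  (1 / 2 : ℝ) • (prodMetric + prodMetric.compl₁₂ (J m) (J m))

/-- The dot product of the vector parts in `ℝ³` of two (imaginary) quaternions. -/
def imDot (a b : ℍ[ℝ]) : ℝ :=
  ![a.imI, a.imJ, a.imK] ⬝ᵥ ![b.imI, b.imJ, b.imK]

section Surface

variable {M : Type*} [TopologicalSpace M] [ChartedSpace (EuclideanSpace ℝ (Fin 2)) M]

/-- The differential `T_x M → T_{φ x} (S³ × S³) ⊆ ℍ × ℍ` of `φ` at `x`. -/
def dphi (φ : M → S3 × S3) (x : M) : TangentSpace (𝓡 2) x →L[ℝ] (ℍ[ℝ] × ℍ[ℝ]) :=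
  mfderiv (𝓡 2) 𝓘(ℝ, ℍ[ℝ] × ℍ[ℝ]) (fun y => incl (φ y)) x

/-- `φ : M → S³ × S³` is a smoothly immersed surface whose tangent spaces are `J`-invariant. -/
structure IsAlmostComplexSurface (φ : M → S3 × S3) : Prop where
  smooth : ContMDiff (𝓡 2) ((𝓡 3).prod (𝓡 3)) ∞ φ
  immersion : ∀ x, Function.Injective (dphi φ x)
  invariant : ∀ x (X : TangentSpace (𝓡 2) x), ∃ Y : TangentSpace (𝓡 2) x,
    dphi φ x Y = J (φ x) (dphi φ x X)

/-- `φ_u` at the point with coordinate `w = u + i v`. -/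
def phiU (φ : M → S3 × S3) (z : OpenPartialHomeomorph M ℂ) (w : ℂ) : ℍ[ℝ] × ℍ[ℝ] :=
  fderiv ℝ (fun w' : ℂ => incl (φ (z.symm w'))) w 1

/-- `φ_v` at the point with coordinate `w = u + i v`. -/
def phiV (φ : M → S3 × S3) (z : OpenPartialHomeomorph M ℂ) (w : ℂ) : ℍ[ℝ] × ℍ[ℝ] :=
  fderiv ℝ (fun w' : ℂ => incl (φ (z.symm w'))) w Complex.I

/-- `z = u + i v` is a smooth local coordinate system of `M` in which the induced metric is a
multiple of `du² + dv²`, oriented so that `J φ_u = φ_v`. -/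
structure IsIsothermal (φ : M → S3 × S3) (z : OpenPartialHomeomorph M ℂ) : Prop where
  smooth : ContMDiffOn (𝓡 2) 𝓘(ℝ, ℂ) ∞ z z.source
  smooth_symm : ContMDiffOn 𝓘(ℝ, ℂ) (𝓡 2) ∞ z.symm z.target
  conformal : ∀ w ∈ z.target,
    g (φ (z.symm w)) (phiU φ z w) (phiU φ z w) = g (φ (z.symm w)) (phiV φ z w) (phiV φ z w)
  orthogonal : ∀ w ∈ z.target, g (φ (z.symm w)) (phiU φ z w) (phiV φ z w) = 0
  oriented : ∀ w ∈ z.target, J (φ (z.symm w)) (phiU φ z w) = phiV φ z w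

/-- `φ_z = (1 / 2) (φ_u - i φ_v)`, in the complexification of `ℍ × ℍ`. -/
def phiZ (φ : M → S3 × S3) (z : OpenPartialHomeomorph M ℂ) (w : ℂ) : ℂ ⊗[ℝ] (ℍ[ℝ] × ℍ[ℝ]) :=
  (1 / 2 : ℂ) • (1 ⊗ₜ[ℝ] phiU φ z w - Complex.I ⊗ₜ[ℝ] phiV φ z w)

/-- `Λ = g (P φ_z, φ_z)`, with `P` extended complex linearly and `g` complex bilinearly, as a
function of the coordinate. -/
def Lambda (φ : M → S3 × S3) (z : OpenPartialHomeomorph M ℂ) (w : ℂ) : ℂ :=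
  (g (φ (z.symm w))).baseChange ℂ ((P (φ (z.symm w))).baseChange ℂ (phiZ φ z w)) (phiZ φ z w)

/-- `α = p⁻¹ p_u`, where `φ = (p, q)`. -/
def alpha (φ : M → S3 × S3) (z : OpenPartialHomeomorph M ℂ) (w : ℂ) : ℍ[ℝ] :=
  ((φ (z.symm w)).1 : ℍ[ℝ])⁻¹ * (phiU φ z w).1

/-- `β = p⁻¹ p_v`, where `φ = (p, q)`. -/
def beta (φ : M → S3 × S3) (z : OpenPartialHomeomorph M ℂ) (w : ℂ) : ℍ[ℝ] :=
  ((φ (z.symm w)).1 : ℍ[ℝ])⁻¹ * (phiV φ z w).1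

/-- The complex valued differential `dz` at `x`. -/
def dCoord (z : OpenPartialHomeomorph M ℂ) (x : M) : TangentSpace (𝓡 2) x →L[ℝ] ℂ :=
  mfderiv (𝓡 2) 𝓘(ℝ, ℂ) z x

/-- `Q` is a holomorphic quadratic differential on `M`: on each tangent space it is homogeneous
quadratic over `ℂ`, for the complex structure which sends `X` to the `Y` with `dφ Y = J dφ X`,
and in every isothermal coordinate it is `h(z) dz²` with `h` holomorphic. -/
structure IsHolomorphicQuadraticDifferential (φ : M → S3 × S3)
    (Q : ∀ x : M, QuadraticMap ℝ (TangentSpace (𝓡 2) x) ℂ) : Prop where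
  complex_homogeneous : ∀ x (X Y : TangentSpace (𝓡 2) x),
    dphi φ x Y = J (φ x) (dphi φ x X) →
      ∀ a b : ℝ, Q x (a • X + b • Y) = ((a : ℂ) + b * Complex.I) ^ 2 * Q x X
  holomorphic : ∀ z : OpenPartialHomeomorph M ℂ, IsIsothermal φ z →
    ∃ h : ℂ → ℂ, DifferentiableOn ℂ h z.target ∧
      ∀ x ∈ z.source, ∀ X : TangentSpace (𝓡 2) x, Q x X = h (z x) * dCoord z x X ^ 2

/-- `P (T_x M) ⊥ T_x M` with respect to `g`. -/
def PPerpAt (φ : M → S3 × S3) (x : M) : Prop :=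
  ∀ X Y : TangentSpace (𝓡 2) x, g (φ x) (P (φ x) (dphi φ x X)) (dphi φ x Y) = 0

/-- `α · α - β · β = 0` and `α · β = 0` on the whole coordinate domain. -/
def AlphaBetaCond (φ : M → S3 × S3) (z : OpenPartialHomeomorph M ℂ) : Prop :=
  ∀ w ∈ z.target,
    imDot (alpha φ z w) (alpha φ z w) - imDot (beta φ z w) (beta φ z w) = 0 ∧
      imDot (alpha φ z w) (beta φ z w) = 0

end Surface

end NearlyKahler

end

open NearlyKahler

open NearlyKahler

noncomputable section

namespace NearlyKahler

/-! Left translation writes a tangent vector at `(p, q)` as `(p a, q b)`. In this frame `J` has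
constant coefficients, `P` swaps the entries and the product metric is the standard one, so `J² =
-1`, `PJ = -JP`, `J` is a `g`-isometry and `P` is `g`-symmetric. Hence `holForm` is symmetric and
complex bilinear with respect to `J`. Its pullback by `dφ` is a coordinate-free `Q`, equal to `Λ
dz²` in every isothermal coordinate.

For holomorphy, `J φ_u = φ_v` expresses `q⁻¹q_u` and `q⁻¹q_v` linearly through `α` and `β`, and `Λ`
becomes a nonzero constant times `|α|² - |β|² - 2i α·β` (`holForm_self_translate`). The
Maurer-Cartan equations of `p` and `q` give `α_v - β_u = [α, β]` and `α_u + β_v = [α, β]/√3`.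
Commutators are orthogonal to both factors, which yields the Cauchy-Riemann equations.

The formula for `Λ` also gives (i) ⇔ (ii), as `α` and `β` are imaginary. For (iii), `g(PX, X)` is
twice the real part of `holForm`, and polarization handles pairs of vectors. -/

lemma inner_mul_mul_left (p a b : ℍ[ℝ]) :
    inner ℝ (p * a) (p * b) = Quaternion.normSq p * inner ℝ a b := by
  simp only [Quaternion.inner_def, Quaternion.normSq_def', Quaternion.re_mul, Quaternion.imI_mul,
    Quaternion.imJ_mul, Quaternion.imK_mul, Quaternion.re_star, Quaternion.imI_star,
    Quaternion.imJ_star, Quaternion.imK_star]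
  ring

/-- The commutator is twice the cross product of the imaginary parts. -/
lemma inner_commutator_self (a b : ℍ[ℝ]) : inner ℝ a (a * b - b * a) = 0 := by
  simp only [Quaternion.inner_def, Quaternion.re_mul, Quaternion.imI_mul, Quaternion.imJ_mul,
    Quaternion.imK_mul, Quaternion.re_star, Quaternion.imI_star, Quaternion.imJ_star,
    Quaternion.imK_star, Quaternion.re_sub, Quaternion.imI_sub, Quaternion.imJ_sub,
    Quaternion.imK_sub]
  ring

lemma inner_eq_re_mul_re_add_imDot (a b : ℍ[ℝ]) : inner ℝ a b = a.re * b.re + imDot a b := by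
  simp [Quaternion.inner_def, imDot, Matrix.vecHead, Matrix.vecTail]
  ring

lemma normSq_coe (p : S3) : Quaternion.normSq (p : ℍ[ℝ]) = 1 := by
  rw [Quaternion.normSq_eq_norm_mul_self, norm_eq_of_mem_sphere, mul_one]

lemma coe_ne_zero (p : S3) : (p : ℍ[ℝ]) ≠ 0 := ne_zero_of_mem_unit_sphere p

lemma inner_mul_mul_left_coe (p : S3) (a b : ℍ[ℝ]) :
    inner ℝ ((p : ℍ[ℝ]) * a) (p * b) = inner ℝ a b := by
  rw [inner_mul_mul_left, normSq_coe, one_mul]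

lemma prodMetric_apply (X Y : ℍ[ℝ] × ℍ[ℝ]) :
    prodMetric X Y = inner ℝ X.1 Y.1 + inner ℝ X.2 Y.2 := rfl

lemma prodMetric_comm (X Y : ℍ[ℝ] × ℍ[ℝ]) : prodMetric X Y = prodMetric Y X := by
  simp only [prodMetric_apply, real_inner_comm]

lemma g_apply (m : S3 × S3) (X Y : ℍ[ℝ] × ℍ[ℝ]) :
    g m X Y = (1 / 2 : ℝ) * (prodMetric X Y + prodMetric (J m X) (J m Y)) := rfl

/-! ### Algebra of `J`, `P` and `g` in the left-translated frame -/

/-- The left translate `(p a, q b)` of `(a, b)` to `(p, q)`. -/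
def translate (m : S3 × S3) (a b : ℍ[ℝ]) : ℍ[ℝ] × ℍ[ℝ] := ((m.1 : ℍ[ℝ]) * a, (m.2 : ℍ[ℝ]) * b)

lemma translate_inv_mul (m : S3 × S3) (X : ℍ[ℝ] × ℍ[ℝ]) :
    translate m ((m.1 : ℍ[ℝ])⁻¹ * X.1) ((m.2 : ℍ[ℝ])⁻¹ * X.2) = X := by
  simp [translate, coe_ne_zero]

lemma exists_translate (m : S3 × S3) (X : ℍ[ℝ] × ℍ[ℝ]) : ∃ a b, X = translate m a b :=
  ⟨_, _, (translate_inv_mul m X).symm⟩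

lemma translate_neg (m : S3 × S3) (a b : ℍ[ℝ]) : -translate m a b = translate m (-a) (-b) := by
  simp [translate]

lemma J_translate (m : S3 × S3) (a b : ℍ[ℝ]) :
    J m (translate m a b) =
      translate m ((1 / √3 : ℝ) • ((2 : ℝ) • b - a)) ((1 / √3 : ℝ) • ((-2 : ℝ) • a + b)) := by
  simp [J, translate, mul_assoc, coe_ne_zero, mul_sub, mul_add]

lemma P_translate (m : S3 × S3) (a b : ℍ[ℝ]) : P m (translate m a b) = translate m b a := by
  simp [P, translate, mul_assoc, coe_ne_zero]

lemma prodMetric_translate (m : S3 × S3) (a b c d : ℍ[ℝ]) :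
    prodMetric (translate m a b) (translate m c d) = inner ℝ a c + inner ℝ b d := by
  simp only [prodMetric_apply, translate, inner_mul_mul_left_coe]

lemma J_J (m : S3 × S3) (X : ℍ[ℝ] × ℍ[ℝ]) : J m (J m X) = -X := by
  obtain ⟨a, b, rfl⟩ := exists_translate m X
  have h : (1 / √3 : ℝ) * (1 / √3) = 1 / 3 := by
    rw [div_mul_div_comm, Real.mul_self_sqrt (by norm_num), one_mul]
  simp only [J_translate, translate_neg]
  congr 1
  · linear_combination (norm := module) (-3 * h) • a
  · linear_combination (norm := module) (-3 * h) • b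

lemma P_J (m : S3 × S3) (X : ℍ[ℝ] × ℍ[ℝ]) : P m (J m X) = -J m (P m X) := by
  obtain ⟨a, b, rfl⟩ := exists_translate m X
  simp only [J_translate, P_translate, translate_neg]
  congr 1 <;> module

lemma prodMetric_P (m : S3 × S3) (X Y : ℍ[ℝ] × ℍ[ℝ]) :
    prodMetric (P m X) Y = prodMetric X (P m Y) := by
  obtain ⟨a, b, rfl⟩ := exists_translate m X
  obtain ⟨c, d, rfl⟩ := exists_translate m Y
  simp only [P_translate, prodMetric_translate, add_comm]

lemma g_comm (m : S3 × S3) (X Y : ℍ[ℝ] × ℍ[ℝ]) : g m X Y = g m Y X := by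
  simp only [g_apply, prodMetric_comm]

lemma g_J_J (m : S3 × S3) (X Y : ℍ[ℝ] × ℍ[ℝ]) : g m (J m X) (J m Y) = g m X Y := by
  simp only [g_apply, J_J, map_neg, LinearMap.neg_apply, neg_neg, add_comm]

lemma g_J_left (m : S3 × S3) (X Y : ℍ[ℝ] × ℍ[ℝ]) : g m (J m X) Y = -g m X (J m Y) := by
  rw [← g_J_J, J_J, map_neg, LinearMap.neg_apply]

lemma g_P_left (m : S3 × S3) (X Y : ℍ[ℝ] × ℍ[ℝ]) : g m (P m X) Y = g m X (P m Y) := by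
  have h : J m (P m X) = -P m (J m X) := by rw [P_J, neg_neg]
  rw [g_apply, g_apply, h, map_neg, LinearMap.neg_apply, prodMetric_P, prodMetric_P, P_J, map_neg,
    neg_neg]

/-! ### The complex bilinear form behind `Λ` -/

/-- The complex valued form `(g (P X, Y) - i g (P X, J Y)) / 2`. -/
def holForm (m : S3 × S3) : LinearMap.BilinMap ℝ (ℍ[ℝ] × ℍ[ℝ]) ℂ :=
  LinearMap.mk₂ ℝ
    (fun X Y => (1 / 2 : ℂ) * ((g m (P m X) Y : ℂ) - Complex.I * (g m (P m X) (J m Y) : ℂ)))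
    (fun X X' Y => by simp only [map_add, LinearMap.add_apply, Complex.ofReal_add]; ring)
    (fun r X Y => by
      simp only [map_smul, LinearMap.smul_apply, smul_eq_mul, Complex.ofReal_mul,
        Complex.real_smul]; ring)
    (fun X Y Y' => by simp only [map_add, Complex.ofReal_add]; ring)
    (fun r X Y => by
      simp only [map_smul, smul_eq_mul, Complex.ofReal_mul, Complex.real_smul]; ring)

lemma holForm_apply (m : S3 × S3) (X Y : ℍ[ℝ] × ℍ[ℝ]) : holForm m X Y =
    (1 / 2 : ℂ) * ((g m (P m X) Y : ℂ) - Complex.I * (g m (P m X) (J m Y) : ℂ)) := rfl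

lemma holForm_comm (m : S3 × S3) (X Y : ℍ[ℝ] × ℍ[ℝ]) : holForm m X Y = holForm m Y X := by
  have h : g m (P m X) (J m Y) = g m (P m Y) (J m X) := by
    rw [g_P_left, P_J, map_neg, ← g_J_left, g_comm]
  rw [holForm_apply, holForm_apply, h, g_P_left, g_comm]

lemma holForm_J_right (m : S3 × S3) (X Y : ℍ[ℝ] × ℍ[ℝ]) :
    holForm m X (J m Y) = Complex.I * holForm m X Y := by
  simp only [holForm_apply, J_J, map_neg, Complex.ofReal_neg]
  linear_combination (1 / 2 * (g m (P m X) (J m Y) : ℂ)) * Complex.I_mul_I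

lemma holForm_self_add (m : S3 × S3) (X : ℍ[ℝ] × ℍ[ℝ]) (a b : ℝ) :
    holForm m (a • X + b • J m X) (a • X + b • J m X) =
      ((a : ℂ) + b * Complex.I) ^ 2 * holForm m X X := by
  simp only [map_add, map_smul, LinearMap.add_apply, LinearMap.smul_apply, holForm_J_right,
    holForm_comm m (J m X), Complex.real_smul]
  ring

lemma g_P_self_eq_zero (m : S3 × S3) {X : ℍ[ℝ] × ℍ[ℝ]} (h : holForm m X X = 0) :
    g m (P m X) X = 0 := by
  have := congrArg Complex.re h
  simpa [holForm_apply] using this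

/-- Polarization of the symmetric form `g(PX, Y)`. -/
lemma g_P_eq_zero (m : S3 × S3) {X Y : ℍ[ℝ] × ℍ[ℝ]} (hX : holForm m X X = 0)
    (hY : holForm m Y Y = 0) (hXY : holForm m (X + Y) (X + Y) = 0) : g m (P m X) Y = 0 := by
  have h := g_P_self_eq_zero m hXY
  simp only [map_add, LinearMap.add_apply, g_P_self_eq_zero m hX, g_P_self_eq_zero m hY] at h
  rw [g_P_left m Y X, g_comm m Y] at h
  linarith

/-- Of the four terms of the expansion, the two diagonal ones agree because `PJ = -JP`, and the two
mixed ones agree because `P` is symmetric. -/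
lemma g_baseChange_P (m : S3 × S3) (X : ℍ[ℝ] × ℍ[ℝ]) :
    (g m).baseChange ℂ
      ((P m).baseChange ℂ ((1 / 2 : ℂ) • (1 ⊗ₜ[ℝ] X - Complex.I ⊗ₜ[ℝ] J m X)))
      ((1 / 2 : ℂ) • (1 ⊗ₜ[ℝ] X - Complex.I ⊗ₜ[ℝ] J m X)) = holForm m X X := by
  have h₁ : g m (P m (J m X)) X = g m (P m X) (J m X) := by rw [g_P_left, g_comm]
  have h₂ : g m (P m (J m X)) (J m X) = -g m (P m X) X := by
    rw [P_J, map_neg, LinearMap.neg_apply, g_J_J]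
  simp only [map_smul, map_sub, LinearMap.smul_apply, LinearMap.sub_apply,
    LinearMap.baseChange_tmul, LinearMap.BilinForm.baseChange_tmul, holForm_apply, h₁, h₂,
    smul_eq_mul, Complex.real_smul, Complex.ofReal_neg]
  linear_combination (-(1 / 4) * (g m (P m X) X : ℂ)) * Complex.I_mul_I

lemma eq_of_J_translate_eq {m : S3 × S3} {a b c d : ℍ[ℝ]}
    (h : J m (translate m a c) = translate m b d) :
    c = (1 / 2 : ℝ) • (√3 • b + a) ∧ d = (1 / 2 : ℝ) • (b - √3 • a) := by
  rw [J_translate] at h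
  have h₁ := mul_left_cancel₀ (coe_ne_zero m.1) (congrArg Prod.fst h)
  have h₂ := mul_left_cancel₀ (coe_ne_zero m.2) (congrArg Prod.snd h)
  have h₃ : √3 * √3 = (3 : ℝ) := Real.mul_self_sqrt (by norm_num)
  have h₄ : √3 * (1 / √3) = (1 : ℝ) := mul_one_div_cancel (by positivity)
  have h₅ : 1 / √3 = √3 / (3 : ℝ) := by
    rw [div_eq_div_iff (by positivity) (by norm_num), one_mul, h₃]
  have hc : c = (1 / 2 : ℝ) • (√3 • b + a) := by
    rw [← h₁, smul_smul, h₄]; module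
  refine ⟨hc, ?_⟩
  rw [← h₂, h₅, hc]
  linear_combination (norm := module) (1 / 6 * h₃) • b

/-- Eliminating `c` and `d` leaves an expression in the first factor alone; this is how `Λ` comes to
depend only on `α` and `β`. -/
lemma holForm_self_translate (m : S3 × S3) {a b c d : ℍ[ℝ]}
    (h : J m (translate m a c) = translate m b d) :
    holForm m (translate m a c) (translate m a c) =
      (1 / 4 + √3 / 4 * Complex.I) *
        (((inner ℝ a a - inner ℝ b b : ℝ) : ℂ) - 2 * Complex.I * ((inner ℝ a b : ℝ) : ℂ)) := by
  have hJ : J m (P m (translate m a c)) = -translate m d b := by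
    rw [← neg_neg (J m (P m _)), ← P_J, h, P_translate]
  have hg : g m (P m (translate m a c)) (translate m a c) = inner ℝ a c - inner ℝ b d := by
    rw [g_apply, hJ, h, map_neg, LinearMap.neg_apply, P_translate, prodMetric_translate,
      prodMetric_translate, real_inner_comm a c, real_inner_comm b d]
    ring
  have hgJ : g m (P m (translate m a c)) (J m (translate m a c)) =
      inner ℝ c b + inner ℝ a d := by
    rw [g_apply, hJ, J_J, h, map_neg, map_neg, LinearMap.neg_apply, P_translate,
      prodMetric_translate, prodMetric_translate, real_inner_comm a d, real_inner_comm b c]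
    ring
  obtain ⟨rfl, rfl⟩ := eq_of_J_translate_eq h
  rw [holForm_apply, hg, hgJ]
  simp only [inner_add_left, inner_add_right, inner_sub_right, real_inner_smul_left,
    real_inner_smul_right, real_inner_comm a b]
  push_cast
  linear_combination (√3 / 2 * (inner ℝ a b : ℝ) : ℂ) * Complex.I_mul_I

/-! ### Maurer-Cartan equations and holomorphy -/

section MaurerCartan

variable {E A : Type*} [NormedAddCommGroup E] [NormedSpace ℝ E] [NormedDivisionRing A]
  [NormedAlgebra ℝ A]

/-- The left logarithmic derivative `p⁻¹ ∂ₐ p`. -/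
def leftLogDeriv (p : E → A) (a : E) (w : E) : A := (p w)⁻¹ * fderiv ℝ p w a

lemma hasFDerivAt_leftLogDeriv {p : E → A} {w : E} (hp : ContDiffAt ℝ 2 p w) (h₀ : p w ≠ 0)
    (a : E) : ∃ L : E →L[ℝ] A, HasFDerivAt (leftLogDeriv p a) L w ∧ ∀ b,
      L b = (p w)⁻¹ * fderiv ℝ (fderiv ℝ p) w b a - leftLogDeriv p b w * leftLogDeriv p a w := by
  have hd : HasFDerivAt p (fderiv ℝ p w) w := (hp.differentiableAt (by simp)).hasFDerivAt
  have hd₂ : HasFDerivAt (fderiv ℝ p) (fderiv ℝ (fderiv ℝ p) w) w :=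
    ((hp.fderiv_right (m := 1) (by norm_num)).differentiableAt (by simp)).hasFDerivAt
  refine ⟨_, ((hasFDerivAt_inv' h₀).comp w hd).mul' (hd₂.clm_apply (hasFDerivAt_const a w)),
    fun b => ?_⟩
  simp [leftLogDeriv, mul_assoc, sub_eq_add_neg]

/-- The Maurer-Cartan equation for the left logarithmic derivative. -/
lemma fderiv_leftLogDeriv_sub {p : E → A} {w : E} (hp : ContDiffAt ℝ 2 p w) (h₀ : p w ≠ 0)
    (a b : E) :
    fderiv ℝ (leftLogDeriv p a) w b - fderiv ℝ (leftLogDeriv p b) w a =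
      leftLogDeriv p a w * leftLogDeriv p b w - leftLogDeriv p b w * leftLogDeriv p a w := by
  obtain ⟨La, ha, ha'⟩ := hasFDerivAt_leftLogDeriv hp h₀ a
  obtain ⟨Lb, hb, hb'⟩ := hasFDerivAt_leftLogDeriv hp h₀ b
  rw [ha.fderiv, hb.fderiv, ha', hb', (hp.isSymmSndFDerivAt (by simp)).eq]
  abel

end MaurerCartan

/-- Differentiate `‖p‖² = 1`. -/
lemma re_leftLogDeriv {E : Type*} [NormedAddCommGroup E] [NormedSpace ℝ E] {p : E → ℍ[ℝ]} {w : E}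
    (hp : DifferentiableAt ℝ p w) (h₁ : ∀ᶠ x in nhds w, ‖p x‖ = 1) (a : E) :
    (leftLogDeriv p a w).re = 0 := by
  have hc : (fun x => ‖p x‖ ^ 2) =ᶠ[nhds w] fun _ => 1 := h₁.mono fun x hx => by simp [hx]
  have h := hp.hasFDerivAt.norm_sq.congr_of_eventuallyEq hc.symm
  have h' := congrArg (fun L => L a) (h.unique (hasFDerivAt_const (1 : ℝ) w))
  have hn : Quaternion.normSq (p w) = 1 := by
    rw [Quaternion.normSq_eq_norm_mul_self, h₁.self_of_nhds, mul_one]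
  simp [Quaternion.inner_def] at h'
  simp [leftLogDeriv, Quaternion.inv_def, hn]
  linarith

/-- In `f_v - i f_u` the real part combines `h₂` and `h₃`, the imaginary part `h₁` and `h₄`. -/
lemma differentiableAt_complex_inner {E : Type*} [NormedAddCommGroup E] [InnerProductSpace ℝ E]
    {α β : ℂ → E} {w : ℂ} (hα : DifferentiableAt ℝ α w) (hβ : DifferentiableAt ℝ β w)
    (h₁ : inner ℝ (α w) (fderiv ℝ α w 1 + fderiv ℝ β w Complex.I) = 0)
    (h₂ : inner ℝ (β w) (fderiv ℝ α w 1 + fderiv ℝ β w Complex.I) = 0)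
    (h₃ : inner ℝ (α w) (fderiv ℝ α w Complex.I - fderiv ℝ β w 1) = 0)
    (h₄ : inner ℝ (β w) (fderiv ℝ α w Complex.I - fderiv ℝ β w 1) = 0) :
    DifferentiableAt ℂ (fun x => ((inner ℝ (α x) (α x) - inner ℝ (β x) (β x) : ℝ) : ℂ) -
      2 * Complex.I * ((inner ℝ (α x) (β x) : ℝ) : ℂ)) w := by
  have hf := (hα.hasFDerivAt.inner ℝ hα.hasFDerivAt).sub (hβ.hasFDerivAt.inner ℝ hβ.hasFDerivAt)
  have hg := hα.hasFDerivAt.inner ℝ hβ.hasFDerivAt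
  have h := (Complex.ofRealCLM.hasFDerivAt.comp w hf).sub
    ((Complex.ofRealCLM.hasFDerivAt.comp w hg).const_mul (2 * Complex.I))
  rw [differentiableAt_complex_iff_differentiableAt_real]
  refine ⟨h.differentiableAt, ?_⟩
  refine (congrArg (· Complex.I) h.fderiv).trans
    (Eq.trans ?_ (congrArg (Complex.I • · 1) h.fderiv.symm))
  rw [inner_add_right] at h₁ h₂
  rw [inner_sub_right] at h₃ h₄
  apply Complex.ext
  · simp [real_inner_comm (α w), real_inner_comm (β w)]
    simp only [real_inner_comm _ (α w), real_inner_comm _ (β w)] at h₁ h₂ h₃ h₄ ⊢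
    linarith
  · simp [real_inner_comm (α w), real_inner_comm (β w)]
    simp only [real_inner_comm _ (α w), real_inner_comm _ (β w)] at h₁ h₂ h₃ h₄ ⊢
    linarith

/-- The quadratic expression in the left logarithmic derivatives of `p` is holomorphic when those
of `q` are obtained from them by the relations which express `J φ_u = φ_v`. -/
lemma differentiableAt_complex_leftLogDeriv {p q : ℂ → ℍ[ℝ]} {w : ℂ} (hp : ContDiffAt ℝ 2 p w)
    (hq : ContDiffAt ℝ 2 q w) (hp₀ : p w ≠ 0) (hq₀ : q w ≠ 0)
    (h₁ : leftLogDeriv q 1 =ᶠ[nhds w]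
      (1 / 2 : ℝ) • (√3 • leftLogDeriv p Complex.I + leftLogDeriv p 1))
    (h₂ : leftLogDeriv q Complex.I =ᶠ[nhds w]
      (1 / 2 : ℝ) • (leftLogDeriv p Complex.I - √3 • leftLogDeriv p 1)) :
    DifferentiableAt ℂ (fun x =>
      ((inner ℝ (leftLogDeriv p 1 x) (leftLogDeriv p 1 x) -
        inner ℝ (leftLogDeriv p Complex.I x) (leftLogDeriv p Complex.I x) : ℝ) : ℂ) -
      2 * Complex.I * ((inner ℝ (leftLogDeriv p 1 x) (leftLogDeriv p Complex.I x) : ℝ) : ℂ)) w := by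
  have hα : DifferentiableAt ℝ (leftLogDeriv p 1) w :=
    (hasFDerivAt_leftLogDeriv hp hp₀ 1).choose_spec.1.differentiableAt
  have hβ : DifferentiableAt ℝ (leftLogDeriv p Complex.I) w :=
    (hasFDerivAt_leftLogDeriv hp hp₀ Complex.I).choose_spec.1.differentiableAt
  have hP := fderiv_leftLogDeriv_sub hp hp₀ 1 Complex.I
  have hQ := fderiv_leftLogDeriv_sub hq hq₀ 1 Complex.I
  rw [h₁.fderiv_eq, h₂.fderiv_eq, h₁.self_of_nhds, h₂.self_of_nhds,
    fderiv_const_smul (by fun_prop), fderiv_const_smul (by fun_prop),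
    fderiv_add (by fun_prop) (by fun_prop), fderiv_sub (by fun_prop) (by fun_prop),
    fderiv_const_smul (by fun_prop), fderiv_const_smul (by fun_prop)] at hQ
  simp only [smul_apply, add_apply, sub_apply, Pi.smul_apply, Pi.add_apply, Pi.sub_apply] at hQ
  have h₃ : √3 * √3 = (3 : ℝ) := Real.mul_self_sqrt (by norm_num)
  generalize leftLogDeriv p 1 = α at *
  generalize leftLogDeriv p Complex.I = β at *
  have hS : fderiv ℝ α w 1 + fderiv ℝ β w Complex.I =
      (√3 / 3 : ℝ) • (α w * β w - β w * α w) := by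
    -- The substitution has determinant `(1 + 3)/4 = 1`, so it preserves the commutator.
    have hc : (1 / 2 : ℝ) • (√3 • β w + α w) * (1 / 2 : ℝ) • (β w - √3 • α w) -
        (1 / 2 : ℝ) • (β w - √3 • α w) * (1 / 2 : ℝ) • (√3 • β w + α w) =
          α w * β w - β w * α w := by
      simp only [smul_mul_assoc, mul_smul_comm, add_mul, mul_add, sub_mul, mul_sub]
      linear_combination (norm := module) (1 / 4 * h₃) • (α w * β w - β w * α w)
    rw [hc] at hQ
    -- Subtracting half of `hP` from `hQ` cancels `α_v - β_u` and leaves `√3/2` times the left side.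
    linear_combination (norm := module) (2 * √3 / 3 : ℝ) • hQ - (√3 / 3 : ℝ) • hP -
      (1 / 3 * h₃) • (fderiv ℝ α w 1 + fderiv ℝ β w Complex.I)
  refine differentiableAt_complex_inner hα hβ ?_ ?_ ?_ ?_
  · rw [hS, inner_smul_right, inner_commutator_self, mul_zero]
  · rw [hS, inner_smul_right, ← neg_sub, inner_neg_right, inner_commutator_self, neg_zero, mul_zero]
  · rw [hP, inner_commutator_self]
  · rw [hP, ← neg_sub, inner_neg_right, inner_commutator_self, neg_zero]

/-! ### The surface, its coordinates and the quadratic differential -/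

variable {M : Type*} [TopologicalSpace M] [ChartedSpace (EuclideanSpace ℝ (Fin 2)) M]
  {φ : M → S3 × S3} {z : OpenPartialHomeomorph M ℂ}

lemma IsAlmostComplexSurface.contMDiff_incl (hφ : IsAlmostComplexSurface φ) :
    ContMDiff (𝓡 2) 𝓘(ℝ, ℍ[ℝ] × ℍ[ℝ]) ∞ (fun y => incl (φ y)) :=
  (contMDiff_coe_sphere.comp (contMDiff_fst.comp hφ.smooth)).prodMk_space
    (contMDiff_coe_sphere.comp (contMDiff_snd.comp hφ.smooth))

lemma IsAlmostComplexSurface.contDiffOn_incl_symm (hφ : IsAlmostComplexSurface φ)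
    (hz : IsIsothermal φ z) : ContDiffOn ℝ ∞ (fun w => incl (φ (z.symm w))) z.target :=
  (hφ.contMDiff_incl.comp_contMDiffOn hz.smooth_symm).contDiffOn

lemma IsAlmostComplexSurface.exists_dphi_eq_fderiv (hφ : IsAlmostComplexSurface φ)
    (hz : IsIsothermal φ z) {w : ℂ} (hw : w ∈ z.target) (a : ℂ) :
    ∃ X : TangentSpace (𝓡 2) (z.symm w),
      fderiv ℝ (fun w' => incl (φ (z.symm w'))) w a = dphi φ (z.symm w) X := by
  have h₁ : MDifferentiableAt 𝓘(ℝ, ℂ) (𝓡 2) z.symm w :=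
    (hz.smooth_symm.contMDiffAt (z.open_target.mem_nhds hw)).mdifferentiableAt (by simp)
  have h₂ := (hφ.contMDiff_incl (z.symm w)).mdifferentiableAt (by simp)
  refine ⟨mfderiv 𝓘(ℝ, ℂ) (𝓡 2) z.symm w a, ?_⟩
  have h := mfderiv_comp w h₂ h₁
  rw [mfderiv_eq_fderiv] at h
  exact congrArg (fun L => L a) h

lemma IsAlmostComplexSurface.dphi_eq (hφ : IsAlmostComplexSurface φ)
    (hz : IsIsothermal φ z) {x : M} (hx : x ∈ z.source) (X : TangentSpace (𝓡 2) x) :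
    dphi φ x X = (dCoord z x X).re • phiU φ z (z x) + (dCoord z x X).im • phiV φ z (z x) := by
  have hw := z.map_source hx
  have h₁ : MDifferentiableAt (𝓡 2) 𝓘(ℝ, ℂ) z x :=
    (hz.smooth.contMDiffAt (z.open_source.mem_nhds hx)).mdifferentiableAt (by simp)
  have h₂ : MDifferentiableAt 𝓘(ℝ, ℂ) 𝓘(ℝ, ℍ[ℝ] × ℍ[ℝ])
      (fun w => incl (φ (z.symm w))) (z x) :=
    (((hφ.contDiffOn_incl_symm hz).contDiffAt (z.open_target.mem_nhds hw)).differentiableAt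
      (by simp)).mdifferentiableAt
  have h := mfderiv_comp x h₂ h₁
  have he : (fun w => incl (φ (z.symm w))) ∘ z =ᶠ[nhds x] fun y => incl (φ y) := by
    filter_upwards [z.open_source.mem_nhds hx] with y hy
    simp [z.left_inv hy]
  rw [he.mfderiv_eq, mfderiv_eq_fderiv] at h
  have h' : dphi φ x X = fderiv ℝ (fun w => incl (φ (z.symm w))) (z x) (dCoord z x X) :=
    congrArg (fun L => L X) h
  have hd : dCoord z x X = (dCoord z x X).re • (1 : ℂ) + (dCoord z x X).im • Complex.I := by
    simp [Complex.re_add_im]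
  rw [h', phiU, phiV, ← map_smul, ← map_smul, ← map_add, ← hd]

lemma IsIsothermal.Lambda_eq (hz : IsIsothermal φ z) {w : ℂ} (hw : w ∈ z.target) :
    Lambda φ z w = holForm (φ (z.symm w)) (phiU φ z w) (phiU φ z w) := by
  rw [Lambda, phiZ, ← hz.oriented w hw, g_baseChange_P]

lemma IsAlmostComplexSurface.holForm_dphi (hφ : IsAlmostComplexSurface φ)
    (hz : IsIsothermal φ z) {x : M} (hx : x ∈ z.source) (X : TangentSpace (𝓡 2) x) :
    holForm (φ x) (dphi φ x X) (dphi φ x X) = Lambda φ z (z x) * dCoord z x X ^ 2 := by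
  have hw := z.map_source hx
  rw [hφ.dphi_eq hz hx, ← hz.oriented _ hw, hz.Lambda_eq hw, z.left_inv hx, holForm_self_add,
    Complex.re_add_im, mul_comm]

/-- The quadratic differential `X ↦ holForm (dφ X, dφ X)`. -/
def hopfDifferential (φ : M → S3 × S3) (x : M) : QuadraticMap ℝ (TangentSpace (𝓡 2) x) ℂ :=
  (holForm (φ x)).toQuadraticMap.comp (dphi φ x : TangentSpace (𝓡 2) x →ₗ[ℝ] ℍ[ℝ] × ℍ[ℝ])

lemma hopfDifferential_apply (φ : M → S3 × S3) (x : M) (X : TangentSpace (𝓡 2) x) :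
    hopfDifferential φ x X = holForm (φ x) (dphi φ x X) (dphi φ x X) := rfl

lemma IsAlmostComplexSurface.hopfDifferential_eq_zero_iff (hφ : IsAlmostComplexSurface φ) (x : M) :
    hopfDifferential φ x = 0 ↔ PPerpAt φ x := by
  refine ⟨fun h X Y => ?_, fun h => QuadraticMap.ext fun X => ?_⟩
  · have h' (Z : TangentSpace (𝓡 2) x) : holForm (φ x) (dphi φ x Z) (dphi φ x Z) = 0 := by
      rw [← hopfDifferential_apply, h, zero_apply]
    refine g_P_eq_zero _ (h' X) (h' Y) ?_
    rw [← map_add, h']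
  -- Invariance makes `J dφ X` tangent, so the imaginary part of `holForm` vanishes as well.
  · obtain ⟨Y, hY⟩ := hφ.invariant x X
    rw [hopfDifferential_apply, holForm_apply, ← hY, h X X, h X Y]
    simp

/-- The derivatives of `φ = (p, q)` in a coordinate are the left translates of `p⁻¹ ∂ₐ p` and
`q⁻¹ ∂ₐ q`. -/
lemma IsAlmostComplexSurface.fderiv_incl_symm_eq_translate (hφ : IsAlmostComplexSurface φ) (hz : IsIsothermal φ z) {w : ℂ}
    (hw : w ∈ z.target) (a : ℂ) :
    fderiv ℝ (fun w' => incl (φ (z.symm w'))) w a =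
      translate (φ (z.symm w))
        (leftLogDeriv (fun w' => ((φ (z.symm w')).1 : ℍ[ℝ])) a w)
        (leftLogDeriv (fun w' => ((φ (z.symm w')).2 : ℍ[ℝ])) a w) := by
  have hd := ((hφ.contDiffOn_incl_symm hz).contDiffAt (z.open_target.mem_nhds hw)).differentiableAt
    (by simp)
  have h₁ : HasFDerivAt (fun w' => ((φ (z.symm w')).1 : ℍ[ℝ])) _ w := hd.hasFDerivAt.fst
  have h₂ : HasFDerivAt (fun w' => ((φ (z.symm w')).2 : ℍ[ℝ])) _ w := hd.hasFDerivAt.snd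
  rw [leftLogDeriv, leftLogDeriv, h₁.fderiv, h₂.fderiv]
  exact (translate_inv_mul _ _).symm

lemma IsAlmostComplexSurface.alpha_eq (hφ : IsAlmostComplexSurface φ) (hz : IsIsothermal φ z) {w : ℂ}
    (hw : w ∈ z.target) :
    alpha φ z w = leftLogDeriv (fun w' => ((φ (z.symm w')).1 : ℍ[ℝ])) 1 w := by
  rw [alpha, phiU, hφ.fderiv_incl_symm_eq_translate hz hw, translate]
  simp [coe_ne_zero]

lemma IsAlmostComplexSurface.beta_eq (hφ : IsAlmostComplexSurface φ) (hz : IsIsothermal φ z) {w : ℂ}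
    (hw : w ∈ z.target) :
    beta φ z w = leftLogDeriv (fun w' => ((φ (z.symm w')).1 : ℍ[ℝ])) Complex.I w := by
  rw [beta, phiV, hφ.fderiv_incl_symm_eq_translate hz hw, translate]
  simp [coe_ne_zero]

lemma IsAlmostComplexSurface.J_translate_leftLogDeriv (hφ : IsAlmostComplexSurface φ)
    (hz : IsIsothermal φ z) {w : ℂ} (hw : w ∈ z.target) :
    J (φ (z.symm w)) (translate (φ (z.symm w))
        (leftLogDeriv (fun w' => ((φ (z.symm w')).1 : ℍ[ℝ])) 1 w)
        (leftLogDeriv (fun w' => ((φ (z.symm w')).2 : ℍ[ℝ])) 1 w)) =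
      translate (φ (z.symm w))
        (leftLogDeriv (fun w' => ((φ (z.symm w')).1 : ℍ[ℝ])) Complex.I w)
        (leftLogDeriv (fun w' => ((φ (z.symm w')).2 : ℍ[ℝ])) Complex.I w) := by
  rw [← hφ.fderiv_incl_symm_eq_translate hz hw, ← hφ.fderiv_incl_symm_eq_translate hz hw]
  exact hz.oriented w hw

lemma IsAlmostComplexSurface.Lambda_eq_inner (hφ : IsAlmostComplexSurface φ)
    (hz : IsIsothermal φ z) {w : ℂ} (hw : w ∈ z.target) :
    Lambda φ z w = (1 / 4 + √3 / 4 * Complex.I) *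
      (((inner ℝ (alpha φ z w) (alpha φ z w) - inner ℝ (beta φ z w) (beta φ z w) : ℝ) : ℂ) -
        2 * Complex.I * ((inner ℝ (alpha φ z w) (beta φ z w) : ℝ) : ℂ)) := by
  rw [hz.Lambda_eq hw, hφ.alpha_eq hz hw, hφ.beta_eq hz hw, phiU, hφ.fderiv_incl_symm_eq_translate hz hw]
  exact holForm_self_translate _ (hφ.J_translate_leftLogDeriv hz hw)

lemma IsAlmostComplexSurface.differentiableOn_Lambda (hφ : IsAlmostComplexSurface φ)
    (hz : IsIsothermal φ z) : DifferentiableOn ℂ (Lambda φ z) z.target := by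
  intro w hw
  have hn := z.open_target.mem_nhds hw
  have hd := ((hφ.contDiffOn_incl_symm hz).contDiffAt hn).of_le (m := 2) ENat.LEInfty.out
  have hc := differentiableAt_complex_leftLogDeriv
    (p := fun w' => ((φ (z.symm w')).1 : ℍ[ℝ])) (q := fun w' => ((φ (z.symm w')).2 : ℍ[ℝ]))
    hd.fst hd.snd (coe_ne_zero _) (coe_ne_zero _)
    (Filter.mem_of_superset hn fun x hx =>
      (eq_of_J_translate_eq (hφ.J_translate_leftLogDeriv hz hx)).1)
    (Filter.mem_of_superset hn fun x hx =>
      (eq_of_J_translate_eq (hφ.J_translate_leftLogDeriv hz hx)).2)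
  refine ((hc.const_mul (1 / 4 + √3 / 4 * Complex.I)).congr_of_eventuallyEq
    (Filter.mem_of_superset hn fun x hx => ?_)).differentiableWithinAt
  simp only [Set.mem_ofPred_eq, hφ.Lambda_eq_inner hz hx, hφ.alpha_eq hz hx, hφ.beta_eq hz hx]

lemma IsAlmostComplexSurface.re_alpha (hφ : IsAlmostComplexSurface φ) (hz : IsIsothermal φ z)
    {w : ℂ} (hw : w ∈ z.target) : (alpha φ z w).re = 0 ∧ (beta φ z w).re = 0 := by
  have hd : DifferentiableAt ℝ (fun w' => ((φ (z.symm w')).1 : ℍ[ℝ])) w :=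
    (((hφ.contDiffOn_incl_symm hz).contDiffAt (z.open_target.mem_nhds hw)).differentiableAt
      (by simp)).fst
  have h (a : ℂ) := re_leftLogDeriv hd (.of_forall fun _ => norm_eq_of_mem_sphere _) a
  rw [hφ.alpha_eq hz hw, hφ.beta_eq hz hw]
  exact ⟨h _, h _⟩

lemma IsAlmostComplexSurface.Lambda_eq_zero_iff (hφ : IsAlmostComplexSurface φ)
    (hz : IsIsothermal φ z) {w : ℂ} (hw : w ∈ z.target) :
    Lambda φ z w = 0 ↔
      imDot (alpha φ z w) (alpha φ z w) - imDot (beta φ z w) (beta φ z w) = 0 ∧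
        imDot (alpha φ z w) (beta φ z w) = 0 := by
  obtain ⟨hα, hβ⟩ := hφ.re_alpha hz hw
  have hc : (1 / 4 + √3 / 4 * Complex.I : ℂ) ≠ 0 := fun h => by
    have := congrArg Complex.re h
    simp at this
  rw [hφ.Lambda_eq_inner hz hw, mul_eq_zero, or_iff_right hc, Complex.ext_iff]
  simp only [inner_eq_re_mul_re_add_imDot, hα, hβ, mul_zero, zero_add]
  simp

lemma IsAlmostComplexSurface.Lambda_eq_zero_iff_PPerpAt (hφ : IsAlmostComplexSurface φ)
    (hz : IsIsothermal φ z) {x : M} (hx : x ∈ z.source) :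
    Lambda φ z (z x) = 0 ↔ PPerpAt φ x := by
  rw [← hφ.hopfDifferential_eq_zero_iff]
  refine ⟨fun h => QuadraticMap.ext fun X => ?_, fun h => ?_⟩
  · rw [hopfDifferential_apply, hφ.holForm_dphi hz hx, h, zero_mul, zero_apply]
  · have hw := z.map_source hx
    -- `Λ` is the value of the differential on the tangent vector that `dφ` sends to `φ_u`.
    obtain ⟨X, hX⟩ := hφ.exists_dphi_eq_fderiv hz hw 1
    rw [hz.Lambda_eq hw, phiU, hX, ← hopfDifferential_apply, z.left_inv hx, h]
    rfl

lemma IsAlmostComplexSurface.alphaBetaCond_iff (hφ : IsAlmostComplexSurface φ)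
    (hz : IsIsothermal φ z) : AlphaBetaCond φ z ↔ ∀ x ∈ z.source, PPerpAt φ x := by
  refine ⟨fun h x hx => ?_, fun h w hw => ?_⟩
  · rw [← hφ.Lambda_eq_zero_iff_PPerpAt hz hx, hφ.Lambda_eq_zero_iff hz (z.map_source hx)]
    exact h _ (z.map_source hx)
  · rw [← hφ.Lambda_eq_zero_iff hz hw, ← z.right_inv hw,
      hφ.Lambda_eq_zero_iff_PPerpAt hz (z.map_target hw)]
    exact h _ (z.map_target hw)

lemma IsAlmostComplexSurface.isHolomorphicQuadraticDifferential (hφ : IsAlmostComplexSurface φ) :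
    IsHolomorphicQuadraticDifferential φ (hopfDifferential φ) where
  complex_homogeneous x X Y h a b := by
    rw [hopfDifferential_apply, hopfDifferential_apply, map_add, map_smul, map_smul, h,
      holForm_self_add]
  holomorphic z hz :=
    ⟨Lambda φ z, hφ.differentiableOn_Lambda hz, fun _ hx X => hφ.holForm_dphi hz hx X⟩

end NearlyKahler

end

theorem mainTheorem2 {M : Type*} [TopologicalSpace M]
    [ChartedSpace (EuclideanSpace ℝ (Fin 2)) M] [IsManifold (𝓡 2) ∞ M]
    (φ : M → S3 × S3) (hφ : IsAlmostComplexSurface φ) :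
    ∃ Q : ∀ x : M, QuadraticMap ℝ (TangentSpace (𝓡 2) x) ℂ,
      IsHolomorphicQuadraticDifferential φ Q ∧
      (∀ z : OpenPartialHomeomorph M ℂ, IsIsothermal φ z →
        DifferentiableOn ℂ (Lambda φ z) z.target ∧
        (∀ x ∈ z.source, ∀ X : TangentSpace (𝓡 2) x,
          Q x X = Lambda φ z (z x) * dCoord z x X ^ 2) ∧
        [∀ w ∈ z.target, Lambda φ z w = 0,
          AlphaBetaCond φ z,
          ∀ x ∈ z.source, PPerpAt φ x].TFAE) ∧
      ((∀ x, Q x = 0) ↔ ∀ x, PPerpAt φ x) ∧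
      (∀ A : Set (OpenPartialHomeomorph M ℂ), (∀ z ∈ A, IsIsothermal φ z) →
        (∀ x, ∃ z ∈ A, x ∈ z.source) →
        [∀ x, Q x = 0,
          ∀ z ∈ A, AlphaBetaCond φ z,
          ∀ x, PPerpAt φ x].TFAE) := by
  have hQ : (∀ x, hopfDifferential φ x = 0) ↔ ∀ x, PPerpAt φ x :=
    forall_congr' hφ.hopfDifferential_eq_zero_iff
  refine ⟨hopfDifferential φ, hφ.isHolomorphicQuadraticDifferential, fun z hz =>
    ⟨hφ.differentiableOn_Lambda hz, fun x hx X => hφ.holForm_dphi hz hx X, ?_⟩, hQ,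
    fun A hA hcover => ?_⟩
  · tfae_have 1 ↔ 2 := forall₂_congr fun w hw => hφ.Lambda_eq_zero_iff hz hw
    tfae_have 2 ↔ 3 := hφ.alphaBetaCond_iff hz
    tfae_finish
  · tfae_have 1 ↔ 3 := hQ
    tfae_have 3 → 2 := fun h z hz => (hφ.alphaBetaCond_iff (hA z hz)).2 fun x _ => h x
    tfae_have 2 → 3 := fun h x => by
      obtain ⟨z, hz, hx⟩ := hcover x
      exact (hφ.alphaBetaCond_iff (hA z hz)).1 (h z hz) x hx
    tfae_finish
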